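/- **Theorem.** Let $G_1$ and $G_2$ be finite simple connected graphs, each with at least two vertices, let $v_1\in V(G_1)$, $v_2\in V(G_2)$, and let $G=G_1\oplus_v G_2$ be (up to isomorphism) their 1-sum, that is, the graph obtained from disjoint copies of $G_1$ and $G_2$ by identifying $v_1$ and $v_2$ to a single vertex $v$. Put $m=|E(G)|$ and $m_i=|E(G_i)|$. Then $m=m_1+m_2$, Kemeny's constants $\mathscr K(G),\mathscr K(G_1),\mathscr K(G_2)$ of the simple random walks on the three graphs are well defined, and $$\mathscr K(G)=\frac{m_1\bigl(\mathscr K(G_1)+\mu(G_2,v)\bigr)+m_2\bigl(\mathscr K(G_2)+\mu(G_1,v)\bigr)}{m_1+m_2}.$$ Here, for a finite simple connected graph $H$ with at least two vertices: - $\mathscr K(H)=\sum_{j}\pi_j\,t_{ij}$, where $\pi$ is the unique stationary distribution of the simple random walk on $H$ (from a vertex, move to a uniformly chosen neighbour) and $t_{ij}$ is the expected time of the first visit to $j$ of the walk started at $i$, with $t_{ii}=0$. That $\mathscr K(H)$ is well defined means that $\pi$ exists and is unique, that every target is hit with probability $1$ and every $t_{ij}$ is finite, and that the sum does not depend on $i$.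 - $r_H(i,j)=(e_i-e_j)^{T}L^{\dagger}(e_i-e_j)$ is the effective resistance, where $L^{\dagger}$ is the Moore–Penrose pseudoinverse of the Laplacian matrix $L$ of $H$ and $e_i$ is the $i$-th standard basis vector. - $\mu(H,v)=\sum_{i\in V(H)}d_i\,r_H(i,v)$ is the moment of $H$ at $v$, where $d_i$ is the degree of $i$ in $H$. In $\mu(G_1,v)$ and $\mu(G_2,v)$ the vertex $v$ stands for $v_1$ and $v_2$ respectively. -/

import Mathlib

open scoped Matrix

/-! ### Markov chains on a finite state space: hitting times and Kemeny's constant -/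

/-- For the Markov chain with transition matrix `P` started at `i`, the probability that the first
visit to `j` (counting time `0`) happens at time `n`: the sum of the probabilities
`P x₀ x₁ * ⋯ * P xₙ₋₁ xₙ` of all trajectories `x₀, …, xₙ` with `x₀ = i`, `xₙ = j` and
`xₖ ≠ j` for all `k < n`. -/
noncomputable def firstHitProb {V : Type*} [Fintype V] [DecidableEq V]
    (P : Matrix V V ℝ) (i j : V) (n : ℕ) : ℝ :=
  ∑ x : Fin (n + 1) → V with
      x 0 = i ∧ x (Fin.last n) = j ∧ ∀ k : Fin n, x k.castSucc ≠ j,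
    ∏ k : Fin n, P (x k.castSucc) (x k.succ)

/-- `t` is the (finite) expected hitting time of `j` for the chain started at `i`: the chain hits
`j` with probability `1`, and the first hitting time has expectation `t`. -/
structure IsMeanHittingTime {V : Type*} [Fintype V] [DecidableEq V]
    (P : Matrix V V ℝ) (i j : V) (t : ℝ) : Prop where
  hits : HasSum (firstHitProb P i j) 1
  mean : HasSum (fun n : ℕ => (n : ℝ) * firstHitProb P i j n) t

/-- `π` is a stationary probability distribution of the chain with transition matrix `P`. -/
structure IsStationaryDist {V : Type*} [Fintype V]
    (P : Matrix V V ℝ) (π : V → ℝ) : Prop where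
  mem_stdSimplex : π ∈ stdSimplex ℝ V
  vecMul_eq : π ᵥ* P = π

/-- `K` is Kemeny's constant of the chain with transition matrix `P`: `P` is a stochastic matrix
with a unique stationary distribution `π`, all expected hitting times `t i j` are finite, and
`K = ∑ j, π j * t i j` for every initial state `i`. -/
def IsKemenyConstant {V : Type*} [Fintype V] [DecidableEq V]
    (P : Matrix V V ℝ) (K : ℝ) : Prop :=
  P ∈ Matrix.rowStochastic ℝ V ∧
  ∃ π : V → ℝ, ∃ t : Matrix V V ℝ,
    (IsStationaryDist P π ∧ ∀ π', IsStationaryDist P π' → π' = π) ∧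
    (∀ i j, IsMeanHittingTime P i j (t i j)) ∧
    ∀ i, ∑ j, π j * t i j = K

/-- On a nonempty state space there is at most one Kemeny constant. -/
theorem IsKemenyConstant.unique {V : Type*} [Fintype V] [DecidableEq V] [Nonempty V]
    {P : Matrix V V ℝ} {K K' : ℝ} (h : IsKemenyConstant P K) (h' : IsKemenyConstant P K') :
    K = K' := by
  obtain ⟨-, π, t, ⟨-, hπ⟩, ht, hK⟩ := h
  obtain ⟨-, π', t', ⟨hπ', -⟩, ht', hK'⟩ := h'
  obtain rfl := hπ π' hπ'
  rw [← hK (Classical.arbitrary V), ← hK' (Classical.arbitrary V)]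
  refine Finset.sum_congr rfl fun j _ => ?_
  rw [(ht _ j).mean.unique (ht' _ j).mean]

/-! ### The Moore–Penrose pseudoinverse -/

/-- `X` satisfies the four Penrose equations for the real square matrix `A`. -/
structure IsMoorePenroseInverse {V : Type*} [Fintype V] (A X : Matrix V V ℝ) : Prop where
  mul_mul_left : A * X * A = A
  mul_mul_right : X * A * X = X
  symm_left : (A * X)ᵀ = A * X
  symm_right : (X * A)ᵀ = X * A

theorem IsMoorePenroseInverse.unique {V : Type*} [Fintype V] {A X Y : Matrix V V ℝ}
    (hX : IsMoorePenroseInverse A X) (hY : IsMoorePenroseInverse A Y) : X = Y := by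
  have h1 : A * X = A * Y := by
    calc A * X = (A * X)ᵀ := hX.symm_left.symm
      _ = ((A * Y) * (A * X))ᵀ := by
          rw [← Matrix.mul_assoc, hY.mul_mul_left]
      _ = (A * X) * (A * Y) := by
          rw [Matrix.transpose_mul, hX.symm_left, hY.symm_left]
      _ = A * Y := by rw [← Matrix.mul_assoc, hX.mul_mul_left]
  have h2 : X * A = Y * A := by
    calc X * A = (X * A)ᵀ := hX.symm_right.symm
      _ = ((X * A) * (Y * A))ᵀ := by
          rw [Matrix.mul_assoc X, ← Matrix.mul_assoc A, hY.mul_mul_left]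
      _ = (Y * A) * (X * A) := by
          rw [Matrix.transpose_mul, hX.symm_right, hY.symm_right]
      _ = Y * A := by rw [Matrix.mul_assoc Y, ← Matrix.mul_assoc A, hX.mul_mul_left]
  calc X = X * A * X := hX.mul_mul_right.symm
    _ = Y * (A * X) := by rw [h2, Matrix.mul_assoc]
    _ = Y * A * Y := by rw [h1, ← Matrix.mul_assoc]
    _ = Y := hY.mul_mul_right

/-- A real symmetric matrix has a Moore–Penrose pseudoinverse. -/
theorem exists_isMoorePenroseInverse {V : Type*} [Fintype V] [DecidableEq V]
    {A : Matrix V V ℝ} (hA : A.IsHermitian) : ∃ X, IsMoorePenroseInverse A X := by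
  obtain ⟨U, d, hU, hAU⟩ : ∃ (U : Matrix V V ℝ) (d : V → ℝ), Uᵀ * U = 1 ∧
      A = U * Matrix.diagonal d * Uᵀ := by
    refine ⟨hA.eigenvectorUnitary, hA.eigenvalues, ?_, ?_⟩
    · have := Unitary.coe_star_mul_self hA.eigenvectorUnitary
      simpa [Matrix.star_eq_conjTranspose] using this
    · have := hA.spectral_theorem
      rw [Unitary.conjStarAlgAut_apply] at this
      simpa [Matrix.star_eq_conjTranspose, Function.comp_def] using this
  have key : ∀ a b : V → ℝ, (U * Matrix.diagonal a * Uᵀ) * (U * Matrix.diagonal b * Uᵀ) =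
      U * Matrix.diagonal (fun v => a v * b v) * Uᵀ := by
    intro a b
    calc _ = U * Matrix.diagonal a * (Uᵀ * U) * Matrix.diagonal b * Uᵀ := by
            simp only [Matrix.mul_assoc]
      _ = _ := by
        rw [hU, Matrix.mul_one, Matrix.mul_assoc U, Matrix.diagonal_mul_diagonal]
  have hsymm : ∀ a : V → ℝ, (U * Matrix.diagonal a * Uᵀ)ᵀ = U * Matrix.diagonal a * Uᵀ := by
    intro a
    simp [Matrix.transpose_mul, Matrix.mul_assoc]
  refine ⟨U * Matrix.diagonal (fun v => (d v)⁻¹) * Uᵀ, ?_, ?_, ?_, ?_⟩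
  · rw [hAU, key, key]
    congr 3
    ext v
    exact mul_inv_mul_cancel (d v)
  · rw [hAU, key, key]
    congr 3
    ext v
    simpa using mul_inv_mul_cancel (d v)⁻¹
  · rw [hAU, key, hsymm]
  · rw [hAU, key, hsymm]

open Classical in
/-- The Moore–Penrose pseudoinverse (which exists for every symmetric matrix and is unique). -/
noncomputable def moorePenroseInverse {V : Type*} [Fintype V] (A : Matrix V V ℝ) :
    Matrix V V ℝ :=
  if h : ∃ X, IsMoorePenroseInverse A X then h.choose else 0

theorem isMoorePenroseInverse_moorePenroseInverse {V : Type*} [Fintype V] [DecidableEq V]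
    {A : Matrix V V ℝ} (hA : A.IsHermitian) :
    IsMoorePenroseInverse A (moorePenroseInverse A) := by
  have h := exists_isMoorePenroseInverse hA
  rw [moorePenroseInverse, dif_pos h]
  exact h.choose_spec

/-! ### Graphs -/

namespace SimpleGraph

/-- Transition matrix of the simple random walk on `G`: from `i`, move to a uniformly chosen
neighbour of `i`. -/
noncomputable def walkMatrix {V : Type*} [Fintype V] (G : SimpleGraph V) [DecidableRel G.Adj] :
    Matrix V V ℝ :=
  Matrix.of fun i j => if G.Adj i j then (G.degree i : ℝ)⁻¹ else 0

/-- Effective resistance `r_G(i, j) = (eᵢ - eⱼ)ᵀ L† (eᵢ - eⱼ)`. -/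
noncomputable def effectiveResistance {V : Type*} [Fintype V] [DecidableEq V]
    (G : SimpleGraph V) [DecidableRel G.Adj] (i j : V) : ℝ :=
  (Pi.single i 1 - Pi.single j 1) ⬝ᵥ
    (moorePenroseInverse (G.lapMatrix ℝ) *ᵥ (Pi.single i 1 - Pi.single j 1))

/-- The moment `μ(G, v) = ∑ i, dᵢ r_G(i, v)`. -/
noncomputable def moment {V : Type*} [Fintype V] [DecidableEq V]
    (G : SimpleGraph V) [DecidableRel G.Adj] (v : V) : ℝ :=
  ∑ i, (G.degree i : ℝ) * G.effectiveResistance i v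

/-- The 1-sum of `G₁` and `G₂` at `v₁`, `v₂`: take disjoint copies of `G₁` and `G₂`, remove `v₁`,
and replace every edge `{i, v₁}` of `G₁` by `{i, v₂}`. -/
def oneSum {V₁ V₂ : Type*} (G₁ : SimpleGraph V₁) (v₁ : V₁) (G₂ : SimpleGraph V₂) (v₂ : V₂) :
    SimpleGraph ({x : V₁ // x ≠ v₁} ⊕ V₂) where
  Adj
    | .inl x, .inl y => G₁.Adj x y
    | .inr x, .inr y => G₂.Adj x y
    | .inl x, .inr y => G₁.Adj x v₁ ∧ y = v₂
    | .inr x, .inl y => G₁.Adj y v₁ ∧ x = v₂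
  symm := ⟨by
    rintro (x | x) (y | y) h
    · exact h.symm
    · exact h
    · exact h
    · exact h.symm⟩
  loopless := ⟨by
    rintro (x | x) h
    · exact G₁.loopless.irrefl _ h
    · exact G₂.loopless.irrefl _ h⟩

end SimpleGraph

/-! ### Hitting times from the first-step equations -/

section HittingTimes

variable {V : Type*} [Fintype V] [DecidableEq V] {P : Matrix V V ℝ}

/-! For a connected graph with m edges, let R = ∑ dᵢ dⱼ r(i,j). Kemeny's constant is R / (4m)
(`Connected.isKemenyConstant`), because t_ij = ½ ∑ₖ dₖ (r(i,j) + r(j,k) - r(i,k)). This formula is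
verified rather than derived: it solves the first-step equations, which in Laplacian form say L h =
d off j, and any solution of them gives the mean hitting times (`isMeanHittingTime_of_firstStep`).

In a 1-sum, resistances inside a part are unchanged, resistances across the cut vertex add, and
degree-weighted sums split over the parts. Hence R(G) = R(G₁) + R(G₂) + 4 (m₁ μ(G₂,v) + m₂ μ(G₁,v))
(`IsOneSum.degreeResistance_eq`), and dividing by 4 (m₁ + m₂) gives the formula. -/

theorem firstHitProb_zero (P : Matrix V V ℝ) (i j : V) :
    firstHitProb P i j 0 = if i = j then 1 else 0 := by
  unfold firstHitProb
  rw [Finset.sum_filter, ← (Equiv.funUnique (Fin 1) V).symm.sum_comp]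
  simp only [Equiv.funUnique_symm_apply, uniqueElim_const, Finset.univ_eq_empty,
    Finset.prod_empty, IsEmpty.forall_iff, and_true]
  rw [Finset.sum_eq_single i]
  · simp
  · intro b _ hb
    rw [if_neg (fun h => hb h.1)]
  · simp

theorem firstHitProb_self_succ (P : Matrix V V ℝ) (j : V) (n : ℕ) :
    firstHitProb P j j (n + 1) = 0 := by
  unfold firstHitProb
  rw [Finset.filter_false_of_mem, Finset.sum_empty]
  rintro x - ⟨h0, -, h⟩
  exact h 0 h0

theorem firstHitProb_succ (P : Matrix V V ℝ) {i j : V} (hij : i ≠ j) (n : ℕ) :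
    firstHitProb P i j (n + 1) = ∑ k, P i k * firstHitProb P k j n := by
  unfold firstHitProb
  rw [Finset.sum_filter, ← (Fin.consEquiv fun _ : Fin (n + 2) => V).sum_comp,
    Fintype.sum_prod_type, Finset.sum_eq_single i]
  · simp_rw [Finset.mul_sum, Finset.sum_filter]
    -- For a fixed tail `x` of the trajectory, only the summand k = `x 0` survives.
    rw [Finset.sum_comm]
    refine Finset.sum_congr rfl fun x _ => ?_
    rw [Finset.sum_eq_single (x 0)]
    · simp [Fin.consEquiv, Fin.forall_fin_succ (n := n), Fin.prod_univ_succ (n := n), hij,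
        ← Fin.succ_last, -Fin.succ_eq_last_succ]
    · intro b _ hb
      rw [if_neg (fun h => hb h.1.symm)]
    · simp
  · intro b _ hb
    refine Finset.sum_eq_zero fun x _ => ?_
    rw [if_neg (fun h => hb ?_)]
    simpa [Fin.consEquiv] using h.1
  · simp

theorem firstHitProb_nonneg (hP : P ∈ Matrix.rowStochastic ℝ V) (i j : V) (n : ℕ) :
    0 ≤ firstHitProb P i j n :=
  Finset.sum_nonneg fun _ _ => Finset.prod_nonneg fun _ _ =>
    Matrix.nonneg_of_mem_rowStochastic hP

/-- Minimum principle for the first-step equations. -/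
theorem nonneg_of_firstStep (hP : P ∈ Matrix.rowStochastic ℝ V) {j : V} {h : V → ℝ}
    (h0 : h j = 0) (h1 : ∀ i, i ≠ j → h i = 1 + ∑ k, P i k * h k) (i : V) : 0 ≤ h i := by
  have : Nonempty V := ⟨j⟩
  obtain ⟨a, ha⟩ := Finite.exists_min h
  by_cases haj : a = j
  · rw [← h0, ← haj]
    exact ha i
  -- At a minimum a ≠ j the row average of h is at least h a, yet h a exceeds that average by 1.
  · exfalso
    have : h a ≤ ∑ k, P a k * h k := by
      calc h a = ∑ k, P a k * h a := by
            rw [← Finset.sum_mul, Matrix.sum_row_of_mem_rowStochastic hP, one_mul]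
        _ ≤ _ := Finset.sum_le_sum fun k _ =>
            mul_le_mul_of_nonneg_left (ha k) (Matrix.nonneg_of_mem_rowStochastic hP)
    linarith [h1 a haj]

/-- If the first-step equations are solvable, only the zero function is harmonic off `j` and
vanishes at `j`. -/
theorem eq_zero_of_harmonic (hP : P ∈ Matrix.rowStochastic ℝ V) {j : V} {h u : V → ℝ}
    (h0 : h j = 0) (h1 : ∀ i, i ≠ j → h i = 1 + ∑ k, P i k * h k)
    (u0 : u j = 0) (u1 : ∀ i, i ≠ j → u i = ∑ k, P i k * u k) (i : V) : u i = 0 := by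
  -- h - c u solves the same first-step equations for every real c, so the minimum principle bounds
  -- c * u i by h i for all c; this forces u i = 0.
  have key : ∀ c : ℝ, 0 ≤ h i - c * u i := fun c =>
    nonneg_of_firstStep (j := j) (h := fun i => h i - c * u i) hP (by simp [h0, u0]) (fun i hi => by
      have : ∑ k, P i k * (c * u k) = c * ∑ k, P i k * u k := by
        rw [Finset.mul_sum]
        exact Finset.sum_congr rfl fun k _ => mul_left_comm _ _ _
      simp only [mul_sub, Finset.sum_sub_distrib]
      rw [this, ← u1 i hi, h1 i hi]
      ring) i
  by_contra hne
  have := key ((h i + 1) / u i)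
  rw [div_mul_cancel₀ _ hne] at this
  linarith

theorem sum_firstHitProb_le_one (hP : P ∈ Matrix.rowStochastic ℝ V) (j : V) (N : ℕ) (i : V) :
    ∑ n ∈ Finset.range N, firstHitProb P i j n ≤ 1 := by
  induction N generalizing i with
  | zero => simp
  | succ N ih =>
    rw [Finset.sum_range_succ', firstHitProb_zero]
    by_cases hij : i = j
    · subst hij
      simp [firstHitProb_self_succ]
    · simp only [firstHitProb_succ P hij, if_neg hij, add_zero]
      rw [Finset.sum_comm]
      simp only [← Finset.mul_sum]
      calc _ ≤ ∑ k, P i k * 1 := Finset.sum_le_sum fun k _ =>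
            mul_le_mul_of_nonneg_left (ih k) (Matrix.nonneg_of_mem_rowStochastic hP)
        _ = 1 := by simp [Matrix.sum_row_of_mem_rowStochastic hP]

/-- Induction on the truncation: writing n + 1 as n plus 1, the first step bounds the truncated mean
by the row average of (mass at most 1) + h. This bound supplies summability. -/
theorem sum_mul_firstHitProb_le (hP : P ∈ Matrix.rowStochastic ℝ V) {j : V} {h : V → ℝ}
    (h0 : h j = 0) (h1 : ∀ i, i ≠ j → h i = 1 + ∑ k, P i k * h k) (N : ℕ) (i : V) :
    ∑ n ∈ Finset.range N, (n : ℝ) * firstHitProb P i j n ≤ h i := by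
  induction N generalizing i with
  | zero => simpa using nonneg_of_firstStep hP h0 h1 i
  | succ N ih =>
    rw [Finset.sum_range_succ']
    by_cases hij : i = j
    · subst hij
      simp [firstHitProb_self_succ, h0]
    · simp only [firstHitProb_succ P hij, Finset.mul_sum]
      rw [Finset.sum_comm, h1 i hij]
      calc _ = ∑ k, P i k * (∑ n ∈ Finset.range N, firstHitProb P k j n +
              ∑ n ∈ Finset.range N, (n : ℝ) * firstHitProb P k j n) := by
            rw [Nat.cast_zero, zero_mul, add_zero]
            refine Finset.sum_congr rfl fun k _ => ?_
            rw [← Finset.sum_add_distrib, Finset.mul_sum]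
            refine Finset.sum_congr rfl fun n _ => ?_
            push_cast
            ring
        _ ≤ ∑ k, P i k * (1 + h k) := Finset.sum_le_sum fun k _ =>
            mul_le_mul_of_nonneg_left (add_le_add (sum_firstHitProb_le_one hP j N k) (ih k))
              (Matrix.nonneg_of_mem_rowStochastic hP)
        _ = _ := by
            simp [mul_add, Finset.sum_add_distrib, Matrix.sum_row_of_mem_rowStochastic hP]

/-- A solution of the first-step equations gives the mean hitting times. -/
theorem isMeanHittingTime_of_firstStep (hP : P ∈ Matrix.rowStochastic ℝ V) {j : V} {h : V → ℝ}
    (h0 : h j = 0) (h1 : ∀ i, i ≠ j → h i = 1 + ∑ k, P i k * h k) (i : V) :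
    IsMeanHittingTime P i j (h i) := by
  have hS : ∀ i, Summable (firstHitProb P i j) := fun i =>
    summable_of_sum_range_le (firstHitProb_nonneg hP i j)
      (fun N => sum_firstHitProb_le_one hP j N i)
  have hM : ∀ i, Summable fun n : ℕ => (n : ℝ) * firstHitProb P i j n := fun i =>
    summable_of_sum_range_le
      (fun n => mul_nonneg n.cast_nonneg (firstHitProb_nonneg hP i j n))
      (fun N => sum_mul_firstHitProb_le hP h0 h1 N i)
  set S : V → ℝ := fun i => ∑' n, firstHitProb P i j n with hSdef
  set M : V → ℝ := fun i => ∑' n : ℕ, (n : ℝ) * firstHitProb P i j n with hMdef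
  have S0 : S j = 1 := by
    simp only [hSdef]
    rw [(hS j).tsum_eq_zero_add]
    simp [firstHitProb_self_succ, firstHitProb_zero]
  have S1 : ∀ i, i ≠ j → S i = ∑ k, P i k * S k := by
    intro i hi
    simp only [hSdef]
    rw [(hS i).tsum_eq_zero_add, firstHitProb_zero, if_neg hi, zero_add]
    simp only [firstHitProb_succ P hi]
    rw [Summable.tsum_finsetSum fun k _ => (hS k).mul_left _]
    simp only [tsum_mul_left]
  have hS1 : ∀ i, S i = 1 := fun i => by
    have := eq_zero_of_harmonic hP h0 h1 (u := fun i => S i - 1) (by simp [S0]) (fun i hi => by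
      simp only [mul_sub, Finset.sum_sub_distrib, mul_one,
        Matrix.sum_row_of_mem_rowStochastic hP, S1 i hi]) i
    linarith
  have M0 : M j = 0 := by
    simp only [hMdef]
    rw [(hM j).tsum_eq_zero_add]
    simp [firstHitProb_self_succ]
  have M1 : ∀ i, i ≠ j → M i = 1 + ∑ k, P i k * M k := by
    intro i hi
    have : ∀ n : ℕ, ((n + 1 : ℕ) : ℝ) * firstHitProb P i j (n + 1) =
        ∑ k, P i k * ((n : ℝ) * firstHitProb P k j n + firstHitProb P k j n) := by
      intro n
      rw [firstHitProb_succ P hi, Finset.mul_sum]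
      refine Finset.sum_congr rfl fun k _ => ?_
      push_cast
      ring
    -- The shift in time contributes the hitting probability S, so S = 1 is needed before this
    -- becomes the first-step equation.
    have hM' : M i = ∑ k, P i k * (M k + S k) := by
      simp only [hMdef, hSdef]
      rw [(hM i).tsum_eq_zero_add, Nat.cast_zero, zero_mul, zero_add]
      simp only [this]
      rw [Summable.tsum_finsetSum fun k _ => ((hM k).add (hS k)).mul_left _]
      refine Finset.sum_congr rfl fun k _ => ?_
      rw [tsum_mul_left, (hM k).tsum_add (hS k)]
    rw [hM']
    simp only [hS1, mul_add, Finset.sum_add_distrib, mul_one,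
      Matrix.sum_row_of_mem_rowStochastic hP]
    ring
  have hMh : M i = h i := by
    have := eq_zero_of_harmonic hP h0 h1 (u := fun i => M i - h i) (by simp [M0, h0])
      (fun i hi => by
        simp only [mul_sub, Finset.sum_sub_distrib, M1 i hi, h1 i hi]
        ring) i
    linarith
  exact ⟨hS1 i ▸ (hS i).hasSum, hMh ▸ (hM i).hasSum⟩

end HittingTimes

/-! ### Random walk, Laplacian and effective resistance of a connected graph -/

namespace SimpleGraph

section Resistance

variable {V : Type*} [Fintype V] [DecidableEq V] (G : SimpleGraph V) [DecidableRel G.Adj]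

theorem sum_degree_mul (f : V → ℝ) :
    ∑ a, (G.degree a : ℝ) * f a = ∑ a, ∑ b, if G.Adj a b then f a else 0 := by
  refine Finset.sum_congr rfl fun a _ => ?_
  rw [degree_eq_sum_if_adj, Finset.sum_mul]
  simp

theorem lapMatrix_mulVec_apply_eq_sum (f : V → ℝ) (a : V) :
    (G.lapMatrix ℝ *ᵥ f) a = ∑ b, if G.Adj a b then f a - f b else 0 := by
  rw [lapMatrix_mulVec_apply, degree_eq_sum_if_adj, Finset.sum_mul, neighborFinset_eq_filter,
    Finset.sum_filter, ← Finset.sum_sub_distrib]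
  refine Finset.sum_congr rfl fun b _ => ?_
  split_ifs <;> simp

theorem dotProduct_lapMatrix_mulVec (g f : V → ℝ) :
    g ⬝ᵥ (G.lapMatrix ℝ *ᵥ f) = ∑ a, ∑ b, if G.Adj a b then g a * (f a - f b) else 0 := by
  simp only [dotProduct, lapMatrix_mulVec_apply_eq_sum, Finset.mul_sum, mul_ite, mul_zero]

theorem sum_lapMatrix_mulVec (f : V → ℝ) : ∑ a, (G.lapMatrix ℝ *ᵥ f) a = 0 := by
  have h := G.lapMatrix_mulVec_const_eq_zero (R := ℝ)
  have : (fun _ => (1 : ℝ)) ⬝ᵥ (G.lapMatrix ℝ *ᵥ f) = 0 := by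
    rw [Matrix.dotProduct_mulVec, ← Matrix.mulVec_transpose, (G.isSymm_lapMatrix (R := ℝ)).eq, h,
      zero_dotProduct]
  simpa [dotProduct] using this

theorem isMoorePenroseInverse_lapMatrix :
    IsMoorePenroseInverse (G.lapMatrix ℝ) (moorePenroseInverse (G.lapMatrix ℝ)) :=
  isMoorePenroseInverse_moorePenroseInverse (G.isHermitian_lapMatrix ℝ)

/-- The effective resistance is the potential difference of a unit current flow. -/
theorem effectiveResistance_eq_of_potential {x y : V} {f : V → ℝ}
    (hf : G.lapMatrix ℝ *ᵥ f = Pi.single x 1 - Pi.single y 1) :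
    G.effectiveResistance x y = f x - f y := by
  have h := G.isMoorePenroseInverse_lapMatrix.mul_mul_left
  unfold effectiveResistance
  -- With u = L f, uᵀ L† u = fᵀ L L† L f = fᵀ L f = f x - f y.
  rw [← hf, Matrix.mulVec_mulVec, ← Matrix.vecMul_transpose, (G.isSymm_lapMatrix (R := ℝ)).eq,
    ← Matrix.dotProduct_mulVec, Matrix.mulVec_mulVec, ← Matrix.mul_assoc, h, hf, dotProduct_sub]
  simp

theorem effectiveResistance_self (x : V) : G.effectiveResistance x x = 0 := by
  simp [effectiveResistance]

theorem effectiveResistance_comm (x y : V) :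
    G.effectiveResistance x y = G.effectiveResistance y x := by
  unfold effectiveResistance
  rw [← neg_sub (Pi.single y 1), Matrix.mulVec_neg, dotProduct_neg, neg_dotProduct, neg_neg]

variable {G}

theorem Connected.eq_const_of_lapMatrix_mulVec_eq_zero (hG : G.Connected) {f : V → ℝ}
    (hf : G.lapMatrix ℝ *ᵥ f = 0) (a b : V) : f a = f b :=
  (G.lapMatrix_mulVec_eq_zero_iff_forall_reachable).1 hf a b (hG.preconnected a b)

/-- On a connected graph the Poisson equation is solved by the pseudoinverse. -/
theorem Connected.lapMatrix_mulVec_moorePenroseInverse (hG : G.Connected) {u : V → ℝ}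
    (hu : ∑ a, u a = 0) :
    G.lapMatrix ℝ *ᵥ (moorePenroseInverse (G.lapMatrix ℝ) *ᵥ u) = u := by
  have hX := G.isMoorePenroseInverse_lapMatrix
  set L := G.lapMatrix ℝ with hL
  set X := moorePenroseInverse L
  have hLs : Lᵀ = L := (G.isSymm_lapMatrix (R := ℝ)).eq
  have h1 : L * (L * X) = L := by
    rw [← hX.symm_left, Matrix.transpose_mul, hLs, ← Matrix.mul_assoc]
    calc L * Xᵀ * L = (L * X * L)ᵀ := by
          rw [Matrix.transpose_mul, Matrix.transpose_mul, hLs, Matrix.mul_assoc]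
      _ = L := by rw [hX.mul_mul_left, hLs]
  -- The residual lies in the kernel of L, so it is constant by connectedness; its entries sum to
  -- zero, so it vanishes.
  have h2 : L *ᵥ (u - L *ᵥ (X *ᵥ u)) = 0 := by
    rw [Matrix.mulVec_sub, Matrix.mulVec_mulVec, Matrix.mulVec_mulVec, Matrix.mul_assoc, h1,
      sub_self]
  have h3 := hG.eq_const_of_lapMatrix_mulVec_eq_zero h2
  have h4 : ∑ a, (u - L *ᵥ (X *ᵥ u)) a = 0 := by
    simp only [Pi.sub_apply, Finset.sum_sub_distrib, hu, hL, sum_lapMatrix_mulVec, sub_zero]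
  funext a
  have : Nonempty V := ⟨a⟩
  have h5 : (Fintype.card V : ℝ) * (u - L *ᵥ (X *ᵥ u)) a = 0 := by
    rw [← h4, Finset.sum_congr rfl fun b _ => h3 b a, Finset.sum_const, Finset.card_univ,
      nsmul_eq_mul]
  have h6 := (mul_eq_zero.1 h5).resolve_left (by exact_mod_cast Fintype.card_ne_zero)
  rw [Pi.sub_apply] at h6
  linarith

theorem Connected.exists_potential (hG : G.Connected) (x y : V) :
    ∃ f : V → ℝ, G.lapMatrix ℝ *ᵥ f = Pi.single x 1 - Pi.single y 1 :=
  ⟨_, hG.lapMatrix_mulVec_moorePenroseInverse (by simp)⟩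

/-- As a function of its first argument, `r(·, y) - r(·, z)` has Laplacian `2 (e_z - e_y)`. -/
theorem Connected.lapMatrix_mulVec_effectiveResistance_sub (hG : G.Connected) (y z : V) :
    G.lapMatrix ℝ *ᵥ (fun x => G.effectiveResistance x y - G.effectiveResistance x z) =
      (2 : ℝ) • (Pi.single z 1 - Pi.single y 1) := by
  obtain ⟨f, hf⟩ := hG.exists_potential z y
  have key : ∀ x, G.effectiveResistance x y - G.effectiveResistance x z =
      2 * f x - (f y + f z) := by
    intro x
    obtain ⟨g, hg⟩ := hG.exists_potential x y
    have hxz : G.lapMatrix ℝ *ᵥ (g - f) = Pi.single x 1 - Pi.single z 1 := by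
      rw [Matrix.mulVec_sub, hg, hf]
      abel
    -- Reciprocity from the symmetry of L: g z - g y = f x - f y, which eliminates the potential g
    -- depending on x.
    have hrec : g ⬝ᵥ (G.lapMatrix ℝ *ᵥ f) = f ⬝ᵥ (G.lapMatrix ℝ *ᵥ g) := by
      rw [Matrix.dotProduct_mulVec, ← Matrix.mulVec_transpose, (G.isSymm_lapMatrix (R := ℝ)).eq,
        dotProduct_comm]
    rw [hf, hg, dotProduct_sub, dotProduct_sub] at hrec
    simp only [dotProduct_single, mul_one] at hrec
    rw [G.effectiveResistance_eq_of_potential hg, G.effectiveResistance_eq_of_potential hxz]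
    simp only [Pi.sub_apply]
    linarith
  have hc : G.lapMatrix ℝ *ᵥ (fun _ => f y + f z) = 0 := by
    have : (fun _ : V => f y + f z) = (f y + f z) • (fun _ => (1 : ℝ)) := by
      funext
      simp
    rw [this, Matrix.mulVec_smul, lapMatrix_mulVec_const_eq_zero, smul_zero]
  have : (fun x => G.effectiveResistance x y - G.effectiveResistance x z) =
      (2 : ℝ) • f - fun _ => f y + f z := by
    funext x
    simp [key]
  rw [this, Matrix.mulVec_sub, Matrix.mulVec_smul, hf, hc, sub_zero]

end Resistance

/-! ### Stationary distribution, hitting times and Kemeny's constant via resistances -/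

section Kemeny

variable {V : Type*} [Fintype V] [DecidableEq V] {G : SimpleGraph V} [DecidableRel G.Adj]

theorem Connected.degree_pos_real [Nontrivial V] (hG : G.Connected) (a : V) :
    (0 : ℝ) < G.degree a := by
  exact_mod_cast hG.preconnected.degree_pos_of_nontrivial a

/-- This is D P = D - L, the bridge between first-step equations and the Poisson equation. -/
theorem degree_mul_walkMatrix_mulVec (f : V → ℝ) {a : V} (ha : (G.degree a : ℝ) ≠ 0) :
    (G.degree a : ℝ) * (G.walkMatrix *ᵥ f) a = G.degree a * f a - (G.lapMatrix ℝ *ᵥ f) a := by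
  rw [lapMatrix_mulVec_apply, sub_sub_cancel, neighborFinset_eq_filter, Finset.sum_filter,
    Matrix.mulVec, dotProduct, Finset.mul_sum]
  refine Finset.sum_congr rfl fun b _ => ?_
  rw [walkMatrix, Matrix.of_apply]
  split_ifs
  · rw [mul_inv_cancel_left₀ ha]
  · simp

theorem Connected.walkMatrix_mem_rowStochastic [Nontrivial V] (hG : G.Connected) :
    G.walkMatrix ∈ Matrix.rowStochastic ℝ V := by
  rw [Matrix.mem_rowStochastic]
  constructor
  · intro i j
    rw [walkMatrix, Matrix.of_apply]
    split_ifs <;> positivity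
  · funext a
    have ha := (hG.degree_pos_real a).ne'
    have h := degree_mul_walkMatrix_mulVec (G := G) (fun _ => 1) ha
    rw [lapMatrix_mulVec_const_eq_zero] at h
    simpa [ha, Pi.one_def] using h

theorem sum_degree_real (G : SimpleGraph V) [DecidableRel G.Adj] :
    ∑ a, (G.degree a : ℝ) = 2 * G.edgeFinset.card := by
  exact_mod_cast G.sum_degrees_eq_twice_card_edges

theorem Connected.card_edgeFinset_pos [Nontrivial V] (hG : G.Connected) :
    (0 : ℝ) < G.edgeFinset.card := by
  have h : 0 < ∑ a, (G.degree a : ℝ) :=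
    Finset.sum_pos (fun a _ => hG.degree_pos_real a) Finset.univ_nonempty
  rw [sum_degree_real] at h
  linarith

/-- Multiplying by the degrees turns the action of the walk on row vectors into the action on
column vectors (reversibility). -/
theorem Connected.degree_mul_vecMul_walkMatrix [Nontrivial V] (hG : G.Connected) (g : V → ℝ) :
    (fun a => (G.degree a : ℝ) * g a) ᵥ* G.walkMatrix =
      fun a => (G.degree a : ℝ) * g a - (G.lapMatrix ℝ *ᵥ g) a := by
  funext b
  rw [lapMatrix_mulVec_apply, sub_sub_cancel, neighborFinset_eq_filter, Finset.sum_filter,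
    Matrix.vecMul, dotProduct]
  refine Finset.sum_congr rfl fun a _ => ?_
  have ha := (hG.degree_pos_real a).ne'
  rw [walkMatrix, Matrix.of_apply]
  simp only [G.adj_comm b a]
  split_ifs
  · field_simp
  · simp

theorem Connected.isStationaryDist [Nontrivial V] (hG : G.Connected) :
    IsStationaryDist G.walkMatrix (fun a => (G.degree a : ℝ) / (2 * G.edgeFinset.card)) := by
  have hm := hG.card_edgeFinset_pos
  refine ⟨⟨fun a => by positivity, ?_⟩, ?_⟩
  · rw [← Finset.sum_div, sum_degree_real, div_self (by positivity)]
  · have h := hG.degree_mul_vecMul_walkMatrix ((2 * (G.edgeFinset.card : ℝ))⁻¹ • fun _ => 1)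
    rw [Matrix.mulVec_smul, lapMatrix_mulVec_const_eq_zero] at h
    simpa [div_eq_mul_inv] using h

/-- By reversibility π / d lies in the kernel of L, hence is constant; total mass 1 fixes the
constant. -/
theorem Connected.eq_of_isStationaryDist [Nontrivial V] (hG : G.Connected) {π : V → ℝ}
    (hπ : IsStationaryDist G.walkMatrix π) :
    π = fun a => (G.degree a : ℝ) / (2 * G.edgeFinset.card) := by
  have hd := fun a => (hG.degree_pos_real a).ne'
  have hm := hG.card_edgeFinset_pos
  have hπg : π = fun a => (G.degree a : ℝ) * (π a / G.degree a) := by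
    funext a
    rw [mul_div_cancel₀ _ (hd a)]
  have h0 : G.lapMatrix ℝ *ᵥ (fun a => π a / G.degree a) = 0 := by
    have h := hG.degree_mul_vecMul_walkMatrix (fun a => π a / G.degree a)
    rw [← hπg, hπ.vecMul_eq] at h
    funext a
    have := congrFun h a
    rw [mul_div_cancel₀ _ (hd a)] at this
    rw [Pi.zero_apply]
    linarith
  have hc := hG.eq_const_of_lapMatrix_mulVec_eq_zero h0
  funext a
  have h1 : ∑ b, π b = (π a / G.degree a) * (2 * G.edgeFinset.card) := by
    rw [← sum_degree_real, Finset.mul_sum]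
    refine Finset.sum_congr rfl fun b _ => ?_
    rw [← hc b a, div_mul_cancel₀ _ (hd b)]
  rw [hπ.mem_stdSimplex.2] at h1
  rw [div_mul_eq_mul_div, eq_div_iff (hd a), one_mul] at h1
  rw [eq_div_iff (mul_pos two_pos hm).ne', h1]

/-- Mean hitting times in terms of effective resistances. -/
theorem Connected.isMeanHittingTime [Nontrivial V] (hG : G.Connected) (i j : V) :
    IsMeanHittingTime G.walkMatrix i j ((∑ k, (G.degree k : ℝ) * (G.effectiveResistance i j +
      G.effectiveResistance j k - G.effectiveResistance i k)) / 2) := by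
  refine isMeanHittingTime_of_firstStep (j := j) (h := fun i => (∑ k, (G.degree k : ℝ) *
    (G.effectiveResistance i j + G.effectiveResistance j k - G.effectiveResistance i k)) / 2)
    hG.walkMatrix_mem_rowStochastic ?_ ?_ i
  · simp [effectiveResistance_self]
  · intro a haj
    set h : V → ℝ := fun i => (∑ k, (G.degree k : ℝ) * (G.effectiveResistance i j +
      G.effectiveResistance j k - G.effectiveResistance i k)) / 2 with hh
    have ha := (hG.degree_pos_real a).ne'
    have hdecomp : h = ((∑ k, (G.degree k : ℝ) * G.effectiveResistance j k) / 2) • (fun _ => 1) +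
        ∑ k, ((G.degree k : ℝ) / 2) •
          (fun x => G.effectiveResistance x j - G.effectiveResistance x k) := by
      funext x
      simp only [hh, Pi.add_apply, Pi.smul_apply, Finset.sum_apply, smul_eq_mul, mul_one,
        Finset.sum_div, ← Finset.sum_add_distrib]
      refine Finset.sum_congr rfl fun k _ => ?_
      ring
    -- The k-th term has Laplacian dₖ (eₖ - eⱼ); at a ≠ j only k = a contributes.
    have hL : (G.lapMatrix ℝ *ᵥ h) a = G.degree a := by
      rw [hdecomp, Matrix.mulVec_add, Matrix.mulVec_smul, lapMatrix_mulVec_const_eq_zero,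
        smul_zero, zero_add, ← Matrix.mulVecLin_apply, map_sum, Finset.sum_apply]
      simp only [map_smul, Matrix.mulVecLin_apply, hG.lapMatrix_mulVec_effectiveResistance_sub]
      simp [Pi.single_apply, haj]
    have := degree_mul_walkMatrix_mulVec h ha
    rw [hL] at this
    change h a = 1 + (G.walkMatrix *ᵥ h) a
    apply mul_left_cancel₀ ha
    linarith

/-- The sum of effective resistances over all pairs, weighted by the degrees. -/
noncomputable def degreeResistance (G : SimpleGraph V) [DecidableRel G.Adj] : ℝ :=
  ∑ i, (G.degree i : ℝ) * ∑ j, (G.degree j : ℝ) * G.effectiveResistance i j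

/-- Weighting the hitting-time formula by dⱼ and summing over j, the r(i,j) and r(i,k) terms both
give 2m μ(G,i) and cancel, which removes the dependence on i. The 4m is 2m from π times 2 from the
hitting times. -/
theorem Connected.isKemenyConstant [Nontrivial V] (hG : G.Connected) :
    IsKemenyConstant G.walkMatrix (G.degreeResistance / (4 * G.edgeFinset.card)) := by
  have hm := hG.card_edgeFinset_pos
  refine ⟨hG.walkMatrix_mem_rowStochastic, _, _,
    ⟨hG.isStationaryDist, fun π' h => hG.eq_of_isStationaryDist h⟩, hG.isMeanHittingTime, ?_⟩
  intro i
  have h1 : ∀ j, ∑ k, (G.degree k : ℝ) * (G.effectiveResistance i j +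
      G.effectiveResistance j k - G.effectiveResistance i k) =
      2 * G.edgeFinset.card * G.effectiveResistance i j +
      ∑ k, (G.degree k : ℝ) * G.effectiveResistance j k - G.moment i := by
    intro j
    simp only [mul_sub, mul_add, Finset.sum_add_distrib, Finset.sum_sub_distrib,
      ← Finset.sum_mul, sum_degree_real, moment, effectiveResistance_comm G _ i]
  have h2 : ∑ j, (G.degree j : ℝ) * (2 * G.edgeFinset.card * G.effectiveResistance i j +
      ∑ k, (G.degree k : ℝ) * G.effectiveResistance j k - G.moment i) = G.degreeResistance := by
    simp only [mul_sub, mul_add, Finset.sum_add_distrib, Finset.sum_sub_distrib,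
      ← Finset.sum_mul, sum_degree_real, degreeResistance, mul_left_comm _ (2 * _ : ℝ),
      ← Finset.mul_sum, moment, effectiveResistance_comm G _ i]
    ring
  rw [← h2, Finset.sum_div]
  refine Finset.sum_congr rfl fun j _ => ?_
  rw [h1]
  field_simp
  ring

end Kemeny

end SimpleGraph

/-! ### Kemeny's constant of a 1-sum -/

namespace SimpleGraph

variable {V V₁ V₂ : Type*} [Fintype V] [DecidableEq V] [Fintype V₁] [DecidableEq V₁]
  [Fintype V₂] [DecidableEq V₂]
  {G : SimpleGraph V} [DecidableRel G.Adj]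
  {G₁ : SimpleGraph V₁} [DecidableRel G₁.Adj]
  {G₂ : SimpleGraph V₂} [DecidableRel G₂.Adj]
  {φ₁ : V₁ → V} {φ₂ : V₂ → V} {v₁ : V₁} {v₂ : V₂}

/-- `G` is the union of copies of `G₁` and `G₂`, given by the maps `φ₁` and `φ₂`, that have exactly
one common vertex, the image of `v₁` and `v₂`, and no common edge. -/
structure IsOneSum (G : SimpleGraph V) [DecidableRel G.Adj] (G₁ : SimpleGraph V₁)
    [DecidableRel G₁.Adj] (G₂ : SimpleGraph V₂) [DecidableRel G₂.Adj]
    (φ₁ : V₁ → V) (φ₂ : V₂ → V) (v₁ : V₁) (v₂ : V₂) : Prop where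
  glue : φ₁ v₁ = φ₂ v₂
  cover : ∀ w, (∃ x, φ₁ x = w) ∨ ∃ y, φ₂ y = w
  exists_extend : ∀ (f₁ : V₁ → ℝ) (f₂ : V₂ → ℝ), f₁ v₁ = f₂ v₂ →
    ∃ f : V → ℝ, (∀ x, f (φ₁ x) = f₁ x) ∧ ∀ y, f (φ₂ y) = f₂ y
  adj_left : ∀ x y, G₁.Adj x y → G.Adj (φ₁ x) (φ₁ y)
  adj_right : ∀ x y, G₂.Adj x y → G.Adj (φ₂ x) (φ₂ y)
  sum_adj : ∀ F : V → V → ℝ, ∑ a, ∑ b, (if G.Adj a b then F a b else 0) =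
    ∑ a, ∑ b, (if G₁.Adj a b then F (φ₁ a) (φ₁ b) else 0) +
    ∑ a, ∑ b, (if G₂.Adj a b then F (φ₂ a) (φ₂ b) else 0)

/-- Passes from the asymmetric vertex type, where v₁ is deleted, to a description treating both
parts alike. -/
theorem exists_isOneSum (e : G ≃g oneSum G₁ v₁ G₂ v₂) :
    ∃ (φ₁ : V₁ → V) (φ₂ : V₂ → V), IsOneSum G G₁ G₂ φ₁ φ₂ v₁ v₂ := by
  let φ₁ : V₁ → V := fun x => e.symm (if h : x = v₁ then .inr v₂ else .inl ⟨x, h⟩)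
  let φ₂ : V₂ → V := fun y => e.symm (.inr y)
  have hφv : φ₁ v₁ = φ₂ v₂ := by simp [φ₁, φ₂]
  have hφl : ∀ x : {x // x ≠ v₁}, φ₁ x = e.symm (.inl x) := fun x => by simp [φ₁, x.2]
  have hll : ∀ x y : {x // x ≠ v₁}, G.Adj (e.symm (.inl x)) (e.symm (.inl y)) ↔
      G₁.Adj x y := fun x y => e.symm.map_adj_iff
  have hrr : ∀ x y : V₂, G.Adj (e.symm (.inr x)) (e.symm (.inr y)) ↔ G₂.Adj x y :=
    fun x y => e.symm.map_adj_iff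
  have hlr : ∀ (x : {x // x ≠ v₁}) (y : V₂), G.Adj (e.symm (.inl x)) (e.symm (.inr y)) ↔
      G₁.Adj x v₁ ∧ y = v₂ := fun x y => e.symm.map_adj_iff
  have hrl : ∀ (y : V₂) (x : {x // x ≠ v₁}), G.Adj (e.symm (.inr y)) (e.symm (.inl x)) ↔
      y = v₂ ∧ G₁.Adj v₁ x := fun y x => by rw [G.adj_comm, hlr, G₁.adj_comm, and_comm]
  refine ⟨φ₁, φ₂, hφv, fun w => ?_, fun f₁ f₂ h => ?_, fun x y h => ?_,
    fun x y h => (hrr x y).2 h, fun F => ?_⟩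
  · obtain ⟨s, rfl⟩ := e.symm.surjective w
    rcases s with x | y
    · exact .inl ⟨x, hφl x⟩
    · exact .inr ⟨y, rfl⟩
  · refine ⟨fun w => Sum.elim (fun x => f₁ x.1) f₂ (e w), fun x => ?_, fun y => by simp [φ₂]⟩
    by_cases hx : x = v₁
    · simp [φ₁, hx, h]
    · simp [φ₁, hx]
  · by_cases hx : x = v₁ <;> by_cases hy : y = v₁
    · exact absurd (hx.trans hy.symm) h.ne
    · subst hx
      rw [hφv, hφl ⟨y, hy⟩]
      exact (hrl _ _).2 ⟨rfl, h⟩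
    · subst hy
      rw [hφv, hφl ⟨x, hx⟩]
      exact (hlr _ _).2 ⟨h, rfl⟩
    · rw [hφl ⟨x, hx⟩, hφl ⟨y, hy⟩]
      exact (hll _ _).2 h
  · have hsum : ∀ g : V → ℝ, ∑ a, g a =
        ∑ x : {x // x ≠ v₁}, g (e.symm (.inl x)) + ∑ y, g (e.symm (.inr y)) := fun g => by
      rw [← e.symm.toEquiv.sum_comp, Fintype.sum_sum_type]
      rfl
    simp only [hsum, hll, hrr, hlr, hrl]
    -- Splitting v₁ off the sums over `V₁` matches the edges of G₁ at v₁ with the two mixed blocks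
    -- of G.
    simp only [Fintype.sum_eq_add_sum_subtype_ne _ v₁, hφl, hφv, G₁.irrefl, if_false, zero_add,
      Finset.sum_add_distrib, ite_and, Finset.sum_ite_irrel, Finset.sum_ite_eq',
      Finset.sum_const_zero, Finset.mem_univ, if_true]
    ring

/-! ### Connectedness, degree sums and resistances of a 1-sum -/

namespace IsOneSum

theorem connected (h : IsOneSum G G₁ G₂ φ₁ φ₂ v₁ v₂) (hG₁ : G₁.Connected)
    (hG₂ : G₂.Connected) : G.Connected := by
  have key : ∀ w, G.Reachable w (φ₁ v₁) := by
    intro w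
    rcases h.cover w with ⟨x, rfl⟩ | ⟨y, rfl⟩
    · exact (hG₁.preconnected x v₁).map ⟨φ₁, fun {a b} => h.adj_left a b⟩
    · rw [h.glue]
      exact (hG₂.preconnected y v₂).map ⟨φ₂, fun {a b} => h.adj_right a b⟩
  have : Nonempty V := ⟨φ₁ v₁⟩
  exact ⟨fun a b => (key a).trans (key b).symm⟩

/-- The cut vertex occurs in both sums on the right, since its degree is the sum of its degrees in
the parts. -/
theorem sum_degree_mul (h : IsOneSum G G₁ G₂ φ₁ φ₂ v₁ v₂) (f : V → ℝ) :
    ∑ a, (G.degree a : ℝ) * f a = ∑ a, (G₁.degree a : ℝ) * f (φ₁ a) +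
      ∑ a, (G₂.degree a : ℝ) * f (φ₂ a) := by
  rw [G.sum_degree_mul, h.sum_adj, G₁.sum_degree_mul fun a => f (φ₁ a),
    G₂.sum_degree_mul fun a => f (φ₂ a)]

theorem card_edgeFinset (h : IsOneSum G G₁ G₂ φ₁ φ₂ v₁ v₂) :
    G.edgeFinset.card = G₁.edgeFinset.card + G₂.edgeFinset.card := by
  have := h.sum_degree_mul fun _ => 1
  simp only [mul_one, sum_degree_real] at this
  have h2 : (G.edgeFinset.card : ℝ) = G₁.edgeFinset.card + G₂.edgeFinset.card := by linarith
  exact_mod_cast h2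

/-- Potentials on the two parts that agree at the common vertex glue. -/
theorem exists_potential (h : IsOneSum G G₁ G₂ φ₁ φ₂ v₁ v₂) {f₁ : V₁ → ℝ} {f₂ : V₂ → ℝ}
    (hf : f₁ v₁ = f₂ v₂) : ∃ f : V → ℝ, (∀ x, f (φ₁ x) = f₁ x) ∧ (∀ y, f (φ₂ y) = f₂ y) ∧
      ∀ g : V → ℝ, g ⬝ᵥ (G.lapMatrix ℝ *ᵥ f) = (fun x => g (φ₁ x)) ⬝ᵥ (G₁.lapMatrix ℝ *ᵥ f₁) +
        (fun y => g (φ₂ y)) ⬝ᵥ (G₂.lapMatrix ℝ *ᵥ f₂) := by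
  obtain ⟨f, h1, h2⟩ := h.exists_extend f₁ f₂ hf
  refine ⟨f, h1, h2, fun g => ?_⟩
  simp only [dotProduct_lapMatrix_mulVec, h.sum_adj, h1, h2]

/-- Extending a potential by its value at the cut vertex sends no current into the other part. -/
theorem effectiveResistance_left (h : IsOneSum G G₁ G₂ φ₁ φ₂ v₁ v₂) (hG₁ : G₁.Connected)
    (x y : V₁) : G.effectiveResistance (φ₁ x) (φ₁ y) = G₁.effectiveResistance x y := by
  obtain ⟨f₁, hf₁⟩ := hG₁.exists_potential x y
  obtain ⟨f, h1, -, hL⟩ := h.exists_potential (f₁ := f₁) (f₂ := fun _ => f₁ v₁) rfl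
  have hc : G₂.lapMatrix ℝ *ᵥ (fun _ => f₁ v₁) = 0 := by
    funext a
    simp [lapMatrix_mulVec_apply_eq_sum]
  rw [G.effectiveResistance_eq_of_potential (f := f), G₁.effectiveResistance_eq_of_potential hf₁,
    h1, h1]
  -- The Laplacian is tested against all g, which avoids treating the cut vertex separately.
  refine dotProduct_eq _ _ fun g => ?_
  rw [dotProduct_comm, hL, hf₁, hc]
  simp [dotProduct_sub, sub_dotProduct]

theorem effectiveResistance_right (h : IsOneSum G G₁ G₂ φ₁ φ₂ v₁ v₂) (hG₂ : G₂.Connected)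
    (x y : V₂) : G.effectiveResistance (φ₂ x) (φ₂ y) = G₂.effectiveResistance x y := by
  obtain ⟨f₂, hf₂⟩ := hG₂.exists_potential x y
  obtain ⟨f, -, h2, hL⟩ := h.exists_potential (f₁ := fun _ => f₂ v₂) (f₂ := f₂) rfl
  have hc : G₁.lapMatrix ℝ *ᵥ (fun _ => f₂ v₂) = 0 := by
    funext a
    simp [lapMatrix_mulVec_apply_eq_sum]
  rw [G.effectiveResistance_eq_of_potential (f := f), G₂.effectiveResistance_eq_of_potential hf₂,
    h2, h2]
  refine dotProduct_eq _ _ fun g => ?_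
  rw [dotProduct_comm, hL, hf₂, hc]
  simp [dotProduct_sub, sub_dotProduct]

theorem effectiveResistance_cross (h : IsOneSum G G₁ G₂ φ₁ φ₂ v₁ v₂) (hG₁ : G₁.Connected)
    (hG₂ : G₂.Connected) (x : V₁) (y : V₂) : G.effectiveResistance (φ₁ x) (φ₂ y) =
      G₁.effectiveResistance x v₁ + G₂.effectiveResistance y v₂ := by
  obtain ⟨f₁, hf₁⟩ := hG₁.exists_potential x v₁
  obtain ⟨f₂, hf₂⟩ := hG₂.exists_potential v₂ y
  -- Shifting f₂ by a constant makes the potentials agree at the cut vertex, where the unit current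
  -- leaving G₁ enters G₂.
  have hf₂' : G₂.lapMatrix ℝ *ᵥ (fun z => f₂ z + (f₁ v₁ - f₂ v₂)) =
      Pi.single v₂ 1 - Pi.single y 1 := by
    rw [← hf₂]
    funext a
    simp [lapMatrix_mulVec_apply_eq_sum]
  obtain ⟨f, h1, h2, hL⟩ := h.exists_potential (f₁ := f₁)
    (f₂ := fun z => f₂ z + (f₁ v₁ - f₂ v₂)) (by ring)
  rw [G.effectiveResistance_eq_of_potential (f := f), G₁.effectiveResistance_eq_of_potential hf₁,
    G₂.effectiveResistance_comm, G₂.effectiveResistance_eq_of_potential hf₂, h1, h2]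
  · ring
  · refine dotProduct_eq _ _ fun g => ?_
    rw [dotProduct_comm, hL, hf₁, hf₂']
    simp [dotProduct_sub, sub_dotProduct, h.glue]

/-- The double sum splits into four blocks. Each of the two mixed blocks equals 2 m₂ μ(G₁,v₁) + 2 m₁
μ(G₂,v₂), whence the factor 4. -/
theorem degreeResistance_eq (h : IsOneSum G G₁ G₂ φ₁ φ₂ v₁ v₂) (hG₁ : G₁.Connected)
    (hG₂ : G₂.Connected) : G.degreeResistance = G₁.degreeResistance + G₂.degreeResistance +
      4 * (G₁.edgeFinset.card * G₂.moment v₂ + G₂.edgeFinset.card * G₁.moment v₁) := by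
  have hc : ∀ x y, G.effectiveResistance (φ₂ y) (φ₁ x) =
      G₁.effectiveResistance x v₁ + G₂.effectiveResistance y v₂ := fun x y => by
    rw [effectiveResistance_comm, h.effectiveResistance_cross hG₁ hG₂]
  simp only [degreeResistance, h.sum_degree_mul, h.effectiveResistance_left hG₁,
    h.effectiveResistance_right hG₂, h.effectiveResistance_cross hG₁ hG₂, hc, mul_add,
    Finset.sum_add_distrib, ← Finset.sum_mul, moment, sum_degree_real]
  simp only [mul_left_comm _ (2 * _ : ℝ), ← Finset.mul_sum]
  ring

end IsOneSum

end SimpleGraph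

theorem mainTheorem1
    {V V₁ V₂ : Type*} [Fintype V] [DecidableEq V] [Fintype V₁] [DecidableEq V₁]
    [Fintype V₂] [DecidableEq V₂] [Nontrivial V₁] [Nontrivial V₂]
    (G : SimpleGraph V) [DecidableRel G.Adj]
    (G₁ : SimpleGraph V₁) [DecidableRel G₁.Adj]
    (G₂ : SimpleGraph V₂) [DecidableRel G₂.Adj]
    (hG₁ : G₁.Connected) (hG₂ : G₂.Connected) (v₁ : V₁) (v₂ : V₂)
    (e : G ≃g SimpleGraph.oneSum G₁ v₁ G₂ v₂)
    (m m₁ m₂ : ℕ) (hm : m = G.edgeFinset.card)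
    (hm₁ : m₁ = G₁.edgeFinset.card) (hm₂ : m₂ = G₂.edgeFinset.card) :
    m = m₁ + m₂ ∧
    ∃ K K₁ K₂ : ℝ,
      IsKemenyConstant G.walkMatrix K ∧
      IsKemenyConstant G₁.walkMatrix K₁ ∧
      IsKemenyConstant G₂.walkMatrix K₂ ∧
      K = (m₁ * (K₁ + G₂.moment v₂) + m₂ * (K₂ + G₁.moment v₁)) / (m₁ + m₂) := by
  obtain ⟨φ₁, φ₂, h⟩ := SimpleGraph.exists_isOneSum e
  have hG := h.connected hG₁ hG₂
  obtain ⟨a, b, hab⟩ := exists_pair_ne V₂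
  have : Nontrivial V := ⟨e.symm (.inr a), e.symm (.inr b), fun hne => hab (by simpa using hne)⟩
  have hm1 := hG₁.card_edgeFinset_pos
  have hm2 := hG₂.card_edgeFinset_pos
  have hcard := h.card_edgeFinset
  subst hm hm₁ hm₂
  refine ⟨hcard, _, _, _, hG.isKemenyConstant, hG₁.isKemenyConstant, hG₂.isKemenyConstant, ?_⟩
  rw [hcard, h.degreeResistance_eq hG₁ hG₂]
  push_cast
  field_simp
  ring
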